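/- Let $n,d\ge 1$ and let $\mathbb M_n$ denote the algebra of complex $n\times n$ matrices; "positive" means positive semidefinite, $X\le Y$ means that $Y-X$ is positive, and $|X|=(X^*X)^{1/2}$. A pair $(A,B)$ of matrices in $\mathbb M_n$ is called a *monotone pair* if there are a positive $C\in\mathbb M_n$ and two non-negative, non-decreasing functions $f,g$ on $[0,\infty)$ such that $A=f(C)$ and $B=g(C)$ (functional calculus). A monotone pair $(A,B)$ is called *concave* if moreover $A=h(B)$ for some concave function $h:[0,\infty)\to[0,\infty)$. A norm $\|\cdot\|$ on $\mathbb M_d$ is called *symmetric* if $\|UXV\|=\|X\|$ for all $X\in\mathbb M_d$ and all unitaries $U,V\in\mathbb M_d$. Let $(A,B)$ be a concave monotone pair in $\mathbb M_n$ and let $\Phi:\mathbb M_n\to\mathbb M_d$ be a unital positive linear map (i.e. $\Phi(I)=I$ and $\Phi(X)\ge 0$ whenever $X\ge 0$). Then, for some unitary $V\in\mathbb M_d$, $$|\Phi(A)\Phi(B)|\le\frac{\Phi(AB)+V\Phi(AB)V^*}{2}.$$ Consequently, for every symmetric norm $\|\cdot\|$ on $\mathbb M_d$, $$\|\Phi(A)\Phi(B)\|\le\|\Phi(AB)\|.$$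 -/

import Mathlib

open scoped MatrixOrder ComplexOrder

/-- `(A, B)` is a monotone pair of complex `n × n` matrices: there are a positive (semidefinite)
matrix `C` and two non-negative, non-decreasing functions `f`, `g` on `[0, ∞)` such that
`A = f(C)` and `B = g(C)`. The spectrum of `C` is finite, so every function is continuous on it
and `cfc` is the usual functional calculus of the Hermitian matrix `C`. -/
def IsMonotonePair {n : ℕ} (A B : Matrix (Fin n) (Fin n) ℂ) : Prop :=
  ∃ (C : Matrix (Fin n) (Fin n) ℂ) (f g : ℝ → ℝ), 0 ≤ C ∧
    MonotoneOn f (Set.Ici 0) ∧ (∀ t, 0 ≤ t → 0 ≤ f t) ∧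
    MonotoneOn g (Set.Ici 0) ∧ (∀ t, 0 ≤ t → 0 ≤ g t) ∧
    A = cfc f C ∧ B = cfc g C

/-- A monotone pair `(A, B)` is concave if `A = h(B)` for some concave
`h : [0, ∞) → [0, ∞)`. Only the values of `h` on `[0, ∞)` matter, as `B` is positive. -/
def IsConcaveMonotonePair {n : ℕ} (A B : Matrix (Fin n) (Fin n) ℂ) : Prop :=
  IsMonotonePair A B ∧
    ∃ h : ℝ → ℝ, ConcaveOn ℝ (Set.Ici 0) h ∧ (∀ t, 0 ≤ t → 0 ≤ h t) ∧ A = cfc h B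

/-- A symmetric norm on the complex `d × d` matrices: a norm (a seminorm vanishing only at `0`)
with `‖U X V‖ = ‖X‖` for all matrices `X` and all unitaries `U`, `V`. -/
structure IsSymmetricNorm {d : ℕ} (N : Seminorm ℂ (Matrix (Fin d) (Fin d) ℂ)) : Prop where
  eq_zero_of_map_eq_zero : ∀ X, N X = 0 → X = 0
  unitary_invariant : ∀ (U V : Matrix.unitaryGroup (Fin d) ℂ) (X : Matrix (Fin d) (Fin d) ℂ),
    N ((U : Matrix (Fin d) (Fin d) ℂ) * X * (V : Matrix (Fin d) (Fin d) ℂ)) = N X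

/-! Write `B = ∑ bᵢ Eᵢ` spectrally and put `Pᵢ = Φ(Eᵢ)`: positive matrices summing to `1`. With `aᵢ
= h(bᵢ)` and `kᵢ = bᵢ / h(bᵢ)`, one has `D := Φ(A) = ∑ aᵢPᵢ`, `Φ(B) = ∑ kᵢaᵢPᵢ`, `Z := Φ(AB) = ∑
kᵢaᵢ²Pᵢ`. Concavity enters only to make both `h(t)` and `t / h(t)` nondecreasing, so that `a` and
`k` are similarly ordered.

Let `M = ∑ kᵢPᵢ`. The block matrix `[[Z, Φ(B)], [Φ(B), M]]` is positive (`sum_conj_nonneg`), hence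
so is `[[Z, Φ(B)D], [DΦ(B), DMD]]`. Testing it against the polar factor of `DΦ(B)` bounds
`|Φ(A)Φ(B)|` by the average of `Z` and a unitary conjugate of `W = DMD` (`abs_le_of_forall_nonneg`).
It remains to see that `W` lies below a unitary conjugate of `Z`, that is, to compare ordered
eigenvalues. This is `eigenvalues_mul_mul_le`: a min-max argument transported by `MD`, fed by
Cauchy–Schwarz and Chebyshev's sum inequality. The norm inequality follows since symmetric norms are
monotone on positive matrices. -/

open Matrix

namespace Matrix

/-! ### Quadratic forms and the spectral theorem. -/

variable {m : Type*} [Fintype m]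

/-- The real quadratic form `x ↦ re ⟨x, A x⟩` of a complex matrix. -/
noncomputable def quadForm (A : Matrix m m ℂ) (x : m → ℂ) : ℝ := (star x ⬝ᵥ A *ᵥ x).re

theorem quadForm_add (A B : Matrix m m ℂ) (x : m → ℂ) :
    quadForm (A + B) x = quadForm A x + quadForm B x := by
  simp [quadForm, add_mulVec]

theorem quadForm_sub (A B : Matrix m m ℂ) (x : m → ℂ) :
    quadForm (A - B) x = quadForm A x - quadForm B x := by
  simp [quadForm, sub_mulVec]

theorem quadForm_smul (c : ℝ) (A : Matrix m m ℂ) (x : m → ℂ) :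
    quadForm (c • A) x = c * quadForm A x := by
  simp [quadForm, smul_mulVec]

theorem quadForm_sum {ι : Type*} (s : Finset ι) (P : ι → Matrix m m ℂ) (x : m → ℂ) :
    quadForm (∑ i ∈ s, P i) x = ∑ i ∈ s, quadForm (P i) x := by
  simp [quadForm, sum_mulVec, dotProduct_sum]

theorem PosSemidef.quadForm_nonneg {A : Matrix m m ℂ} (hA : A.PosSemidef) (x : m → ℂ) :
    0 ≤ quadForm A x :=
  (Complex.nonneg_iff.mp (hA.dotProduct_mulVec_nonneg x)).1

theorem quadForm_mono {A B : Matrix m m ℂ} (h : A ≤ B) (x : m → ℂ) :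
    quadForm A x ≤ quadForm B x := by
  have := (le_iff.mp h).quadForm_nonneg x
  rw [quadForm_sub] at this
  linarith

theorem mul_mul_conjTranspose_mono {A B : Matrix m m ℂ} (h : A ≤ B) (U : Matrix m m ℂ) :
    U * A * Uᴴ ≤ U * B * Uᴴ := by
  rw [le_iff] at h ⊢
  have := h.mul_mul_conjTranspose_same U
  rwa [Matrix.mul_sub, Matrix.sub_mul] at this

theorem quadForm_mulVec (A T : Matrix m m ℂ) (x : m → ℂ) :
    quadForm A (T *ᵥ x) = quadForm (Tᴴ * A * T) x := by
  simp [quadForm, star_mulVec, dotProduct_mulVec, vecMul_vecMul, Matrix.mul_assoc]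

theorem inner_toLp_col (Y : Matrix m m ℂ) (i j : m) :
    inner ℂ (WithLp.toLp 2 (Yᵀ i)) (WithLp.toLp 2 (Yᵀ j)) = (Yᴴ * Y) i j := by
  simp [EuclideanSpace.inner_eq_star_dotProduct, Matrix.mul_apply, dotProduct, mul_comm]

variable [DecidableEq m]

theorem quadForm_diagonal (l : m → ℝ) (x : m → ℂ) :
    quadForm (diagonal fun i => (l i : ℂ)) x = ∑ i, l i * Complex.normSq (x i) := by
  simp only [quadForm, dotProduct, mulVec_diagonal, Complex.re_sum, Pi.star_apply,
    RCLike.star_def]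
  refine Finset.sum_congr rfl fun i _ => ?_
  simp [Complex.normSq_apply]
  ring

theorem quadForm_one (x : m → ℂ) : quadForm 1 x = ∑ i, Complex.normSq (x i) := by
  have := quadForm_diagonal (fun _ => (1 : ℝ)) x
  simpa using this

theorem quadForm_one_pos {x : m → ℂ} : 0 < quadForm 1 x ↔ x ≠ 0 := by
  rw [quadForm_one, ← not_iff_not, not_lt, ne_eq, not_not]
  constructor
  · intro h
    have h0 := le_antisymm h (Finset.sum_nonneg fun i _ => Complex.normSq_nonneg (x i))
    rw [Finset.sum_eq_zero_iff_of_nonneg fun i _ => Complex.normSq_nonneg (x i)] at h0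
    ext i
    exact Complex.normSq_eq_zero.mp (h0 i (Finset.mem_univ i))
  · rintro rfl
    simp

/-- The spectral theorem in the form `A = U D Uᴴ`. -/
theorem IsHermitian.eq_unitary_mul_diagonal_mul {A : Matrix m m ℂ} (hA : A.IsHermitian) :
    A = (hA.eigenvectorUnitary : Matrix m m ℂ) * diagonal (fun i => (hA.eigenvalues i : ℂ)) *
      (hA.eigenvectorUnitary : Matrix m m ℂ)ᴴ := by
  conv_lhs => rw [hA.spectral_theorem, Unitary.conjStarAlgAut_apply]
  rfl

theorem unitary_conjTranspose_mul_self (U : unitaryGroup m ℂ) :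
    (U : Matrix m m ℂ)ᴴ * (U : Matrix m m ℂ) = 1 :=
  Unitary.coe_star_mul_self U

theorem unitary_mul_conjTranspose_self (U : unitaryGroup m ℂ) :
    (U : Matrix m m ℂ) * (U : Matrix m m ℂ)ᴴ = 1 :=
  Unitary.coe_mul_star_self U

theorem IsHermitian.quadForm_eq {A : Matrix m m ℂ} (hA : A.IsHermitian) (c : m → ℂ) :
    quadForm A ((hA.eigenvectorUnitary : Matrix m m ℂ) *ᵥ c) =
      ∑ i, hA.eigenvalues i * Complex.normSq (c i) := by
  rw [quadForm_mulVec, ← quadForm_diagonal]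
  congr 1
  set U := hA.eigenvectorUnitary
  conv_lhs => rw [hA.eq_unitary_mul_diagonal_mul]
  have h := unitary_conjTranspose_mul_self U
  calc _ = ((U : Matrix m m ℂ)ᴴ * U) * diagonal (fun i => (hA.eigenvalues i : ℂ)) *
        ((U : Matrix m m ℂ)ᴴ * U) := by simp only [Matrix.mul_assoc]; rfl
    _ = _ := by rw [h, Matrix.one_mul, Matrix.mul_one]

theorem IsHermitian.quadForm_mul_self_eq {A : Matrix m m ℂ} (hA : A.IsHermitian) (c : m → ℂ) :
    quadForm (A * A) ((hA.eigenvectorUnitary : Matrix m m ℂ) *ᵥ c) =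
      ∑ i, hA.eigenvalues i ^ 2 * Complex.normSq (c i) := by
  rw [quadForm_mulVec, ← quadForm_diagonal]
  congr 1
  set U := hA.eigenvectorUnitary
  conv_lhs => rw [hA.eq_unitary_mul_diagonal_mul]
  have h := unitary_conjTranspose_mul_self U
  calc _ = ((U : Matrix m m ℂ)ᴴ * U) * diagonal (fun i => (hA.eigenvalues i : ℂ)) *
        ((U : Matrix m m ℂ)ᴴ * U) * diagonal (fun i => (hA.eigenvalues i : ℂ)) *
        ((U : Matrix m m ℂ)ᴴ * U) := by simp only [Matrix.mul_assoc]; rfl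
    _ = _ := by
      rw [h, Matrix.one_mul, Matrix.mul_one, Matrix.mul_one, diagonal_mul_diagonal]
      congr 1
      ext i
      push_cast
      ring

theorem quadForm_one_unitary_mulVec (U : unitaryGroup m ℂ) (c : m → ℂ) :
    quadForm 1 ((U : Matrix m m ℂ) *ᵥ c) = ∑ i, Complex.normSq (c i) := by
  rw [quadForm_mulVec, Matrix.mul_one, unitary_conjTranspose_mul_self, quadForm_one]

/-! ### Comparison of ordered eigenvalues. -/

/-- A min-max comparison of eigenvalues: if a linear map `T` carries the spectral subspaces of `W`
injectively to subspaces on which the quadratic form of `Z` is as large, then the ordered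
eigenvalues of `W` are dominated by those of `Z`. -/
theorem PosSemidef.eigenvalues_le_eigenvalues {W Z : Matrix m m ℂ} (hW : W.PosSemidef)
    (hZ : Z.PosSemidef) (T : Matrix m m ℂ)
    (H : ∀ t : ℝ, 0 < t → ∀ x : m → ℂ, x ≠ 0 → t * quadForm 1 x ≤ quadForm W x →
      t * quadForm W x ≤ quadForm (W * W) x →
      T *ᵥ x ≠ 0 ∧ t * quadForm 1 (T *ᵥ x) ≤ quadForm Z (T *ᵥ x)) (j : m) :
    hW.1.eigenvalues j ≤ hZ.1.eigenvalues j := by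
  by_contra! hlt
  set t := hW.1.eigenvalues j
  have ht : 0 < t := (hZ.eigenvalues_nonneg j).trans_lt hlt
  let e : m ≃ Fin (Fintype.card m) := (Fintype.equivOfCardEq (Fintype.card_fin _)).symm
  have hmono {A : Matrix m m ℂ} (hA : A.IsHermitian) {i k : m} (h : e i ≤ e k) :
      hA.eigenvalues k ≤ hA.eigenvalues i := hA.eigenvalues₀_antitone h
  let U := hW.1.eigenvectorUnitary
  let V := hZ.1.eigenvectorUnitary
  -- Dimension count: `e` lists eigenvalues in decreasing order, and the coordinates up to and
  -- including `j` outnumber by one the conditions at the indices strictly before `j`.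
  obtain ⟨c, hc0, hc1, hc2⟩ : ∃ c : m → ℂ, c ≠ 0 ∧ (∀ i, e j < e i → c i = 0) ∧
      ∀ i, e i < e j → ((V : Matrix m m ℂ)ᴴ *ᵥ (T *ᵥ ((U : Matrix m m ℂ) *ᵥ c))) i = 0 := by
    let ext : ({i // e i ≤ e j} → ℂ) →ₗ[ℂ] (m → ℂ) :=
      { toFun := fun c i => if h : e i ≤ e j then c ⟨i, h⟩ else 0
        map_add' := fun c c' => by ext i; by_cases h : e i ≤ e j <;> simp [h]
        map_smul' := fun a c => by ext i; by_cases h : e i ≤ e j <;> simp [h] }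
    let res : (m → ℂ) →ₗ[ℂ] ({i // e i < e j} → ℂ) := LinearMap.funLeft ℂ ℂ Subtype.val
    let L := res ∘ₗ ((V : Matrix m m ℂ)ᴴ * T * (U : Matrix m m ℂ)).mulVecLin ∘ₗ ext
    have hcard : Fintype.card {i // e i < e j} < Fintype.card {i // e i ≤ e j} :=
      Fintype.card_lt_of_injective_of_notMem
        (fun i : {i // e i < e j} => (⟨i.1, i.2.le⟩ : {i // e i ≤ e j}))
        (fun a b h => Subtype.ext (congrArg (fun z => z.1) h)) (b := ⟨j, le_rfl⟩)
        (by rintro ⟨a, ha⟩; have := congrArg (fun z => z.1) ha; exact absurd a.2 (by simp_all))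
    have hker : LinearMap.ker L ≠ ⊥ :=
      LinearMap.ker_ne_bot_of_finrank_lt (by simpa using hcard)
    obtain ⟨c, hc, hc0⟩ := Submodule.exists_mem_ne_zero_of_ne_bot hker
    refine ⟨ext c, fun h => hc0 ?_, fun i hi => ?_, fun i hi => ?_⟩
    · ext i
      have := congrFun h i.1
      simpa [ext, i.2] using this
    · simp [ext, not_le.mpr hi]
    · have := congrFun (LinearMap.mem_ker.mp hc) ⟨i, hi⟩
      simpa [L, res, LinearMap.funLeft_apply, Matrix.mulVec_mulVec, Matrix.mul_assoc] using this
  let x := (U : Matrix m m ℂ) *ᵥ c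
  have hx1 : quadForm 1 x = ∑ i, Complex.normSq (c i) := quadForm_one_unitary_mulVec U c
  have hx2 : quadForm W x = ∑ i, hW.1.eigenvalues i * Complex.normSq (c i) := hW.1.quadForm_eq c
  have hx3 : quadForm (W * W) x = ∑ i, hW.1.eigenvalues i ^ 2 * Complex.normSq (c i) :=
    hW.1.quadForm_mul_self_eq c
  have hx0 : x ≠ 0 := by
    rw [← quadForm_one_pos, hx1, ← quadForm_one, quadForm_one_pos]
    exact hc0
  obtain ⟨hy0, hy⟩ := H t ht x hx0
    (by
      rw [hx1, hx2, Finset.mul_sum]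
      refine Finset.sum_le_sum fun i _ => ?_
      rcases le_or_gt (e i) (e j) with h | h
      · exact mul_le_mul_of_nonneg_right (hmono hW.1 h) (Complex.normSq_nonneg _)
      · simp [hc1 i h])
    (by
      rw [hx2, hx3, Finset.mul_sum]
      refine Finset.sum_le_sum fun i _ => ?_
      rcases le_or_gt (e i) (e j) with h | h
      · rw [← mul_assoc, sq]
        exact mul_le_mul_of_nonneg_right (mul_le_mul_of_nonneg_right (hmono hW.1 h)
          (hW.eigenvalues_nonneg i)) (Complex.normSq_nonneg _)
      · simp [hc1 i h])
  set y := T *ᵥ x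
  let z := (V : Matrix m m ℂ)ᴴ *ᵥ y
  have hyz : y = (V : Matrix m m ℂ) *ᵥ z := by
    simp only [z, Matrix.mulVec_mulVec, unitary_mul_conjTranspose_self, Matrix.one_mulVec]
  have hy1 : quadForm 1 y = ∑ i, Complex.normSq (z i) := by
    rw [hyz]; exact quadForm_one_unitary_mulVec V z
  have hy2 : quadForm Z y = ∑ i, hZ.1.eigenvalues i * Complex.normSq (z i) := by
    rw [hyz]; exact hZ.1.quadForm_eq z
  have hle : quadForm Z y ≤ hZ.1.eigenvalues j * quadForm 1 y := by
    rw [hy1, hy2, Finset.mul_sum]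
    refine Finset.sum_le_sum fun i _ => ?_
    rcases lt_or_ge (e i) (e j) with h | h
    · have : z i = 0 := hc2 i h
      simp [this]
    · exact mul_le_mul_of_nonneg_right (hmono hZ.1 h) (Complex.normSq_nonneg _)
  exact absurd (hy.trans hle) (not_le.mpr (mul_lt_mul_of_pos_right hlt (quadForm_one_pos.mpr hy0)))

theorem PosSemidef.eigenvalues_mono {P Q : Matrix m m ℂ} (hP : P.PosSemidef) (hQ : Q.PosSemidef)
    (h : P ≤ Q) (j : m) : hP.1.eigenvalues j ≤ hQ.1.eigenvalues j := by
  refine hP.eigenvalues_le_eigenvalues hQ 1 (fun t _ x hx h1 _ => ?_) j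
  rw [Matrix.one_mulVec]
  exact ⟨hx, h1.trans (quadForm_mono h x)⟩

/-- Rotating the eigenbasis of `Z` onto that of `W` reduces the claim to diagonal matrices. -/
theorem PosSemidef.exists_unitary_le {W Z : Matrix m m ℂ} (hW : W.PosSemidef) (hZ : Z.PosSemidef)
    (h : ∀ j, hW.1.eigenvalues j ≤ hZ.1.eigenvalues j) :
    ∃ V : unitaryGroup m ℂ, W ≤ (V : Matrix m m ℂ) * Z * (V : Matrix m m ℂ)ᴴ := by
  let U₁ := hW.1.eigenvectorUnitary
  let U₂ := hZ.1.eigenvectorUnitary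
  refine ⟨U₁ * star U₂, ?_⟩
  have hd : diagonal (fun i => (hW.1.eigenvalues i : ℂ)) ≤
      diagonal (fun i => (hZ.1.eigenvalues i : ℂ)) := by
    rw [le_iff, diagonal_sub]
    refine PosSemidef.diagonal fun i => ?_
    have := h i
    simp only [Pi.zero_apply, ← Complex.ofReal_sub]
    exact_mod_cast sub_nonneg.mpr this
  have h2 := unitary_conjTranspose_mul_self U₂
  have hZ' : (U₂ : Matrix m m ℂ)ᴴ * Z * U₂ = diagonal (fun i => (hZ.1.eigenvalues i : ℂ)) := by
    conv_lhs => rw [hZ.1.eq_unitary_mul_diagonal_mul]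
    calc _ = ((U₂ : Matrix m m ℂ)ᴴ * U₂) * diagonal (fun i => (hZ.1.eigenvalues i : ℂ)) *
          ((U₂ : Matrix m m ℂ)ᴴ * U₂) := by simp only [Matrix.mul_assoc]; rfl
      _ = _ := by rw [h2, Matrix.one_mul, Matrix.mul_one]
  have h3 := mul_mul_conjTranspose_mono hd (U₁ : Matrix m m ℂ)
  rw [← hZ', ← hW.1.eq_unitary_mul_diagonal_mul] at h3
  refine h3.trans_eq ?_
  simp [Matrix.mul_assoc, star_eq_conjTranspose]

/-! ### Polar decomposition and block positivity. -/

/-- A matrix with orthogonal columns is the product of a unitary and a diagonal matrix. -/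
theorem exists_eq_unitary_mul_diagonal (Y : Matrix m m ℂ) (s : m → ℝ)
    (h : Yᴴ * Y = diagonal fun i => ((s i) ^ 2 : ℂ)) :
    ∃ U : unitaryGroup m ℂ, Y = (U : Matrix m m ℂ) * diagonal fun i => (s i : ℂ) := by
  -- Normalise the columns with `s i ≠ 0` and extend them to an orthonormal basis; the other columns
  -- of `Y` vanish, so any basis vectors serve there.
  let u : m → EuclideanSpace ℂ m := fun i => ((s i : ℂ)⁻¹) • WithLp.toLp 2 (Yᵀ i)
  have hu : Orthonormal ℂ (Set.domRestrict {i | s i ≠ 0} u) := by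
    rw [orthonormal_iff_ite]
    rintro ⟨i, hi⟩ ⟨j, hj⟩
    have hi' : (s i : ℂ) ≠ 0 := by exact_mod_cast hi
    simp only [Set.domRestrict_apply, u, inner_smul_left, inner_smul_right, inner_toLp_col, h]
    by_cases hij : i = j
    · subst hij
      simp
      field_simp
    · simp [hij]
  obtain ⟨b, hb⟩ := Orthonormal.exists_orthonormalBasis_extension_of_card_eq (by simp) hu
  refine ⟨⟨(EuclideanSpace.basisFun m ℂ).toBasis.toMatrix b,
    (EuclideanSpace.basisFun m ℂ).toMatrix_orthonormalBasis_mem_unitary b⟩, ?_⟩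
  ext k i
  rw [mul_diagonal]
  change Y k i = b i k * _
  by_cases hi : s i = 0
  · have h0 : WithLp.toLp 2 (Yᵀ i) = 0 := by
      rw [← inner_self_eq_zero (𝕜 := ℂ), inner_toLp_col, h]
      simp [hi]
    have := congrArg (fun v : EuclideanSpace ℂ m => v k) h0
    simpa [hi] using this
  · have hi' : (s i : ℂ) ≠ 0 := by exact_mod_cast hi
    rw [hb i hi]
    simp [u]
    field_simp

theorem posSemidef_abs (X : Matrix m m ℂ) : (CFC.abs X).PosSemidef :=
  nonneg_iff_posSemidef.mp (CFC.abs_nonneg X)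

/-- Polar decomposition of a square complex matrix. -/
theorem exists_unitary_mul_abs (X : Matrix m m ℂ) :
    ∃ U : unitaryGroup m ℂ, X = (U : Matrix m m ℂ) * CFC.abs X := by
  have hG := (posSemidef_abs X).1
  let V := hG.eigenvectorUnitary
  have hV := unitary_conjTranspose_mul_self V
  have hV' := unitary_mul_conjTranspose_self V
  have hGV := hG.eq_unitary_mul_diagonal_mul
  obtain ⟨U, hU⟩ := exists_eq_unitary_mul_diagonal (X * (V : Matrix m m ℂ)) hG.eigenvalues (by
    have h1 : (X * (V : Matrix m m ℂ))ᴴ * (X * V) =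
        (V : Matrix m m ℂ)ᴴ * (CFC.abs X * CFC.abs X) * V := by
      rw [CFC.abs_mul_abs, conjTranspose_mul, star_eq_conjTranspose]
      simp only [Matrix.mul_assoc]
    rw [h1]
    conv_lhs => rw [hGV]
    calc _ = ((V : Matrix m m ℂ)ᴴ * V) * diagonal (fun i => (hG.eigenvalues i : ℂ)) *
          ((V : Matrix m m ℂ)ᴴ * V) * diagonal (fun i => (hG.eigenvalues i : ℂ)) *
          ((V : Matrix m m ℂ)ᴴ * V) := by simp only [Matrix.mul_assoc]; rfl
      _ = _ := by
        rw [hV, Matrix.one_mul, Matrix.mul_one, Matrix.mul_one, diagonal_mul_diagonal]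
        simp only [sq])
  refine ⟨U * star V, ?_⟩
  calc X = X * V * (V : Matrix m m ℂ)ᴴ := by rw [Matrix.mul_assoc, hV', Matrix.mul_one]
    _ = U * ((V : Matrix m m ℂ)ᴴ * V) * diagonal (fun i => (hG.eigenvalues i : ℂ)) *
        (V : Matrix m m ℂ)ᴴ := by rw [hU, hV, Matrix.mul_one]
    _ = (U * (V : Matrix m m ℂ)ᴴ) * (V * diagonal (fun i => (hG.eigenvalues i : ℂ)) *
        (V : Matrix m m ℂ)ᴴ) := by simp only [Matrix.mul_assoc]
    _ = (U * (V : Matrix m m ℂ)ᴴ) * CFC.abs X := by rw [← hGV]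

/-- A bound on `|X|` from the positivity of the block matrix `[[Z, Xᴴ], [X, W]]`. -/
theorem abs_le_of_forall_nonneg {X Z W : Matrix m m ℂ}
    (h : ∀ U : Matrix m m ℂ, 0 ≤ Z - Xᴴ * U - Uᴴ * X + Uᴴ * W * U) :
    ∃ U : unitaryGroup m ℂ,
      CFC.abs X ≤ (1 / 2 : ℝ) • (Z + (U : Matrix m m ℂ) * W * (U : Matrix m m ℂ)ᴴ) := by
  obtain ⟨U, hU⟩ := exists_unitary_mul_abs X
  have hU1 : (U : Matrix m m ℂ)ᴴ * X = CFC.abs X := by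
    conv_lhs => rw [hU]
    rw [← Matrix.mul_assoc, unitary_conjTranspose_mul_self, Matrix.one_mul]
  have hU2 : Xᴴ * (U : Matrix m m ℂ) = CFC.abs X := by
    have := congrArg conjTranspose hU1
    rwa [conjTranspose_mul, conjTranspose_conjTranspose, (posSemidef_abs X).1.eq] at this
  refine ⟨star U, ?_⟩
  have := h U
  rw [hU1, hU2] at this
  have h2 := nonneg_iff_posSemidef.mp this
  rw [le_iff]
  have h3 := h2.smul (a := (1 / 2 : ℝ)) (by norm_num)
  convert h3 using 1
  simp only [Unitary.coe_star, star_eq_conjTranspose, conjTranspose_conjTranspose]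
  module

/-! ### Symmetric norms are monotone on positive matrices. -/

/-- Each `c i` is the real part of a point of the unit circle, the average of that point and its
conjugate. -/
theorem exists_diagonal_unitary (c : m → ℝ) (h0 : ∀ i, 0 ≤ c i) (h1 : ∀ i, c i ≤ 1) :
    ∃ D : unitaryGroup m ℂ, diagonal (fun i => (c i : ℂ)) =
      (1 / 2 : ℝ) • ((D : Matrix m m ℂ) + (star D : unitaryGroup m ℂ)) := by
  let w : m → ℂ := fun i => ⟨c i, √(1 - c i ^ 2)⟩
  have hw (i : m) : w i * star (w i) = 1 := by
    have : (0 : ℝ) ≤ 1 - c i ^ 2 := by nlinarith [h0 i, h1 i]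
    have hs := Real.mul_self_sqrt this
    apply Complex.ext
    · simp [w]
      linarith
    · simp [w]
      ring
  refine ⟨⟨diagonal w, ?_⟩, ?_⟩
  · rw [mem_unitaryGroup_iff, star_eq_conjTranspose, diagonal_conjTranspose, diagonal_mul_diagonal,
      ← diagonal_one]
    congr 1
    ext1 i
    exact hw i
  · simp only [Unitary.coe_star, star_eq_conjTranspose, diagonal_conjTranspose, diagonal_add,
      ← diagonal_smul]
    congr 1
    ext1 i
    apply Complex.ext <;> simp [w]
    ring

end Matrix

theorem IsSymmetricNorm.unitary_mul {d : ℕ} {N : Seminorm ℂ (Matrix (Fin d) (Fin d) ℂ)}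
    (hN : IsSymmetricNorm N) (U : unitaryGroup (Fin d) ℂ) (X : Matrix (Fin d) (Fin d) ℂ) :
    N ((U : Matrix (Fin d) (Fin d) ℂ) * X) = N X := by
  simpa using hN.unitary_invariant U 1 X

theorem Seminorm.half_smul_add_le {d : ℕ} {N : Seminorm ℂ (Matrix (Fin d) (Fin d) ℂ)}
    {X Y : Matrix (Fin d) (Fin d) ℂ} {r : ℝ} (hX : N X ≤ r) (hY : N Y ≤ r) :
    N ((1 / 2 : ℝ) • (X + Y)) ≤ r := by
  have h : (1 / 2 : ℝ) • (X + Y) = (1 / 2 : ℂ) • (X + Y) := by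
    ext i j
    simp [mul_add]
  rw [h, map_smul_eq_mul]
  have := map_add_le_add N X Y
  have h2 : ‖(1 / 2 : ℂ)‖ = 1 / 2 := by simp
  rw [h2]
  linarith

theorem IsSymmetricNorm.eq_diagonal {d : ℕ} {N : Seminorm ℂ (Matrix (Fin d) (Fin d) ℂ)}
    (hN : IsSymmetricNorm N) {P : Matrix (Fin d) (Fin d) ℂ} (hP : P.IsHermitian) :
    N P = N (diagonal fun i => (hP.eigenvalues i : ℂ)) := by
  conv_lhs => rw [hP.eq_unitary_mul_diagonal_mul]
  exact hN.unitary_invariant hP.eigenvectorUnitary (star hP.eigenvectorUnitary) _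

theorem IsSymmetricNorm.mono {d : ℕ} {N : Seminorm ℂ (Matrix (Fin d) (Fin d) ℂ)}
    (hN : IsSymmetricNorm N) {P Q : Matrix (Fin d) (Fin d) ℂ} (hP : P.PosSemidef)
    (hQ : Q.PosSemidef) (h : P ≤ Q) : N P ≤ N Q := by
  rw [hN.eq_diagonal hP.1, hN.eq_diagonal hQ.1]
  have hle := hP.eigenvalues_mono hQ h
  -- Where an eigenvalue of `Q` vanishes, so does that of `P`, and the ratio `0 / 0 = 0` is
  -- harmless.
  obtain ⟨D, hD⟩ := exists_diagonal_unitary (fun i => hP.1.eigenvalues i / hQ.1.eigenvalues i)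
    (fun i => div_nonneg (hP.eigenvalues_nonneg i) (hQ.eigenvalues_nonneg i))
    (fun i => div_le_one_of_le₀ (hle i) (hQ.eigenvalues_nonneg i))
  have hmul : diagonal (fun i => (hP.1.eigenvalues i : ℂ)) =
      diagonal (fun i => ((hP.1.eigenvalues i / hQ.1.eigenvalues i : ℝ) : ℂ)) *
        diagonal fun i => (hQ.1.eigenvalues i : ℂ) := by
    rw [diagonal_mul_diagonal]
    congr 1
    ext1 i
    rw [← Complex.ofReal_mul, div_mul_cancel_of_imp]
    intro h0
    exact le_antisymm (h0 ▸ hle i) (hP.eigenvalues_nonneg i)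
  rw [hmul, hD, Matrix.smul_mul, Matrix.add_mul]
  exact Seminorm.half_smul_add_le (hN.unitary_mul D _).le (hN.unitary_mul (star D) _).le

/-! ### Chebyshev inequalities for positive operator-valued measures. -/

namespace Matrix

variable {m ι : Type*} [Fintype ι]

theorem posSemidef_sum_smul {P : ι → Matrix m m ℂ} (hP : ∀ i, (P i).PosSemidef) {k : ι → ℝ}
    (hk : ∀ i, 0 ≤ k i) : (∑ i, k i • P i).PosSemidef :=
  posSemidef_sum _ fun i _ => (hP i).smul (hk i)

/-- Twice the difference of the two sides is the double sum of `pᵢpⱼ(qᵢ - qⱼ)(kᵢ - kⱼ)`. -/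
theorem sum_mul_sum_le_of_monovary (p q k : ι → ℝ) (hp : ∀ i, 0 ≤ p i)
    (hqk : ∀ i j, 0 ≤ (q i - q j) * (k i - k j)) :
    (∑ i, q i * p i) * (∑ i, k i * p i) ≤ (∑ i, q i * k i * p i) * ∑ i, p i := by
  have h : 0 ≤ ∑ i, ∑ j, p i * p j * ((q i - q j) * (k i - k j)) :=
    Finset.sum_nonneg fun i _ => Finset.sum_nonneg fun j _ =>
      mul_nonneg (mul_nonneg (hp i) (hp j)) (hqk i j)
  have e : ∑ i, ∑ j, p i * p j * ((q i - q j) * (k i - k j)) =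
      2 * ((∑ i, q i * k i * p i) * ∑ i, p i) - 2 * ((∑ i, q i * p i) * ∑ i, k i * p i) := by
    have e1 : ∑ i, ∑ j, p i * p j * ((q i - q j) * (k i - k j)) =
        ((∑ i, q i * k i * p i) * ∑ i, p i) + ((∑ i, p i) * ∑ i, q i * k i * p i) -
        ((∑ i, q i * p i) * ∑ i, k i * p i) - ((∑ i, k i * p i) * ∑ i, q i * p i) := by
      simp only [Finset.sum_mul_sum, ← Finset.sum_add_distrib, ← Finset.sum_sub_distrib]
      refine Finset.sum_congr rfl fun i _ => Finset.sum_congr rfl fun j _ => ?_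
      ring
    rw [e1]
    ring
  linarith

variable [Fintype m] [DecidableEq m]

/-- The expression is `∑ kᵢ (aᵢ - T)ᴴ Pᵢ (aᵢ - T)`. -/
theorem sum_conj_nonneg {P : ι → Matrix m m ℂ} (hP : ∀ i, (P i).PosSemidef) (a k : ι → ℝ)
    (hk : ∀ i, 0 ≤ k i) (T : Matrix m m ℂ) :
    0 ≤ ∑ i, (k i * a i ^ 2) • P i - (∑ i, (k i * a i) • P i) * T -
      Tᴴ * (∑ i, (k i * a i) • P i) + Tᴴ * (∑ i, k i • P i) * T := by
  have h : 0 ≤ ∑ i, k i • ((a i • 1 - T)ᴴ * P i * (a i • 1 - T)) :=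
    Finset.sum_nonneg fun i _ => nonneg_iff_posSemidef.mpr
      (((hP i).conjTranspose_mul_mul_same _).smul (hk i))
  refine h.trans_eq ?_
  simp only [Finset.sum_mul, Finset.mul_sum, ← Finset.sum_sub_distrib, ← Finset.sum_add_distrib]
  refine Finset.sum_congr rfl fun i _ => ?_
  simp only [conjTranspose_sub, conjTranspose_smul, conjTranspose_one, star_trivial,
    Matrix.sub_mul, Matrix.mul_sub, Matrix.smul_mul, Matrix.mul_smul, Matrix.one_mul,
    Matrix.mul_one]
  module

theorem sq_sum_smul_le {P : ι → Matrix m m ℂ} (hP : ∀ i, (P i).PosSemidef) (h1 : ∑ i, P i = 1)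
    (a : ι → ℝ) : (∑ i, a i • P i) * (∑ i, a i • P i) ≤ ∑ i, (a i ^ 2) • P i := by
  have h := sum_conj_nonneg hP a (fun _ => 1) (fun _ => zero_le_one) (∑ i, a i • P i)
  have hH : (∑ i, a i • P i)ᴴ = ∑ i, a i • P i := by
    simp [conjTranspose_sum, conjTranspose_smul, (hP _).1.eq]
  simp only [one_mul, one_smul, h1, hH, Matrix.mul_one, sub_add_cancel] at h
  exact sub_nonneg.mp h

/-- A Chebyshev inequality for the quadratic forms of a positive operator-valued measure. -/
theorem quadForm_mul_quadForm_le {P : ι → Matrix m m ℂ} (hP : ∀ i, (P i).PosSemidef)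
    (h1 : ∑ i, P i = 1) (q k : ι → ℝ) (hqk : ∀ i j, 0 ≤ (q i - q j) * (k i - k j)) (y : m → ℂ) :
    quadForm (∑ i, q i • P i) y * quadForm (∑ i, k i • P i) y ≤
      quadForm (∑ i, (q i * k i) • P i) y * quadForm 1 y := by
  rw [← h1]
  simp only [quadForm_sum, quadForm_smul]
  exact sum_mul_sum_le_of_monovary _ q k (fun i => (hP i).quadForm_nonneg y) hqk

/-- Cauchy–Schwarz for the form of `M` between `u` and `M u`, read off the discriminant of its value
at `u + t M u`. -/
theorem PosSemidef.sq_quadForm_mulVec_le {M : Matrix m m ℂ} (hM : M.PosSemidef) (u : m → ℂ) :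
    quadForm 1 (M *ᵥ u) ^ 2 ≤ quadForm M u * quadForm M (M *ᵥ u) := by
  have h : ∀ t : ℝ, 0 ≤ quadForm M (M *ᵥ u) * (t * t) + 2 * quadForm 1 (M *ᵥ u) * t +
      quadForm M u := by
    intro t
    have ht := hM.quadForm_nonneg ((1 + t • M) *ᵥ u)
    rw [quadForm_mulVec] at ht
    refine ht.trans_eq ?_
    rw [quadForm_mulVec, quadForm_mulVec, Matrix.mul_one, hM.1.eq]
    have e : (1 + t • M)ᴴ * M * (1 + t • M) = (t * t) • (M * M * M) + (2 * t) • (M * M) + M := by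
      simp only [conjTranspose_add, conjTranspose_smul, conjTranspose_one, star_trivial, hM.1.eq,
        Matrix.add_mul, Matrix.mul_add, Matrix.smul_mul, Matrix.mul_smul, Matrix.one_mul,
        Matrix.mul_one]
      module
    rw [e]
    simp only [quadForm_add, quadForm_smul]
    ring
  have := discrim_le_zero h
  rw [discrim] at this
  linarith

/-- For a positive operator-valued measure `P` and functions `a`, `k` such that `a ^ 2` and `k`
are monovariant, the ordered eigenvalues of `(∑ aᵢPᵢ) (∑ kᵢPᵢ) (∑ aᵢPᵢ)` are dominated by those of
`∑ aᵢ²kᵢPᵢ`. -/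
theorem eigenvalues_mul_mul_le {P : ι → Matrix m m ℂ} (hP : ∀ i, (P i).PosSemidef)
    (h1 : ∑ i, P i = 1) (a k : ι → ℝ) (hk : ∀ i, 0 ≤ k i)
    (hak : ∀ i j, 0 ≤ (a i ^ 2 - a j ^ 2) * (k i - k j))
    (hW : ((∑ i, a i • P i) * (∑ i, k i • P i) * (∑ i, a i • P i)).PosSemidef)
    (hZ : (∑ i, (a i ^ 2 * k i) • P i).PosSemidef) (j : m) :
    hW.1.eigenvalues j ≤ hZ.1.eigenvalues j := by
  refine hW.eigenvalues_le_eigenvalues hZ ((∑ i, k i • P i) * (∑ i, a i • P i))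
    (fun t ht x hx hx1 hx2 => ?_) j
  have hC := quadForm_mul_quadForm_le hP h1 (fun i => a i ^ 2) k hak
  have hQ := quadForm_mono (sq_sum_smul_le hP h1 a)
  have hM : (∑ i, k i • P i).PosSemidef := posSemidef_sum_smul hP hk
  have hD : (∑ i, a i • P i)ᴴ = ∑ i, a i • P i := by
    simp [conjTranspose_sum, conjTranspose_smul, (hP _).1.eq]
  set D := ∑ i, a i • P i
  set M := ∑ i, k i • P i
  have hcs := hM.sq_quadForm_mulVec_le (D *ᵥ x)
  rw [mulVec_mulVec, quadForm_mulVec M D, hD] at hcs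
  set y := (M * D) *ᵥ x with hy
  have hDy : quadForm (D * M * D * (D * M * D)) x = quadForm (D * D) y := by
    rw [hy, quadForm_mulVec, conjTranspose_mul, hD, hM.1.eq]
    simp only [Matrix.mul_assoc]
  rw [hDy] at hx2
  have hxpos := quadForm_one_pos.mpr hx
  have hWpos : 0 < quadForm (D * M * D) x := (mul_pos ht hxpos).trans_le hx1
  have hy0 : y ≠ 0 := by
    intro h0
    have : quadForm (D * D) y = 0 := by simp [h0, quadForm]
    nlinarith [mul_pos ht hWpos]
  refine ⟨hy0, ?_⟩
  have hN := quadForm_one_pos.mpr hy0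
  have hMy := hM.quadForm_nonneg y
  -- Cauchy–Schwarz at `D x` bounds `‖y‖⁴`; the spectral condition on `x` trades `t⟨x, Wx⟩` for `⟨x,
  -- W²x⟩ = ⟨y, D²y⟩`; Chebyshev concludes.
  refine le_of_mul_le_mul_right ?_ hN
  calc t * quadForm 1 y * quadForm 1 y = t * quadForm 1 y ^ 2 := by ring
    _ ≤ t * (quadForm (D * M * D) x * quadForm M y) := by gcongr
    _ = t * quadForm (D * M * D) x * quadForm M y := by ring
    _ ≤ quadForm (∑ i, (a i ^ 2) • P i) y * quadForm M y := by
      gcongr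
      exact hx2.trans (hQ y)
    _ ≤ _ := hC y

/-- The weighted operator Chebyshev inequality for a positive operator-valued measure. -/
theorem exists_unitary_abs_sum_mul_sum_le {P : ι → Matrix m m ℂ} (hP : ∀ i, (P i).PosSemidef)
    (h1 : ∑ i, P i = 1) (a k : ι → ℝ) (ha : ∀ i, 0 ≤ a i) (hk : ∀ i, 0 ≤ k i)
    (hak : ∀ i j, 0 ≤ (a i - a j) * (k i - k j)) :
    ∃ V : unitaryGroup m ℂ,
      CFC.abs ((∑ i, a i • P i) * (∑ i, (k i * a i) • P i)) ≤
        (1 / 2 : ℝ) • (∑ i, (k i * a i ^ 2) • P i +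
          (V : Matrix m m ℂ) * (∑ i, (k i * a i ^ 2) • P i) * (V : Matrix m m ℂ)ᴴ) := by
  have hZ : (∑ i, (k i * a i ^ 2) • P i).PosSemidef :=
    posSemidef_sum_smul hP fun i => mul_nonneg (hk i) (sq_nonneg _)
  have hM : (∑ i, k i • P i).PosSemidef := posSemidef_sum_smul hP hk
  have hD : (∑ i, a i • P i)ᴴ = ∑ i, a i • P i := (posSemidef_sum_smul hP ha).1.eq
  have hB : (∑ i, (k i * a i) • P i)ᴴ = ∑ i, (k i * a i) • P i :=
    (posSemidef_sum_smul hP fun i => mul_nonneg (hk i) (ha i)).1.eq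
  have hW : ((∑ i, a i • P i) * (∑ i, k i • P i) * (∑ i, a i • P i)).PosSemidef := by
    have := hM.mul_mul_conjTranspose_same (∑ i, a i • P i)
    rwa [hD] at this
  have hcomm : ∑ i, (a i ^ 2 * k i) • P i = ∑ i, (k i * a i ^ 2) • P i := by simp only [mul_comm]
  have hle := eigenvalues_mul_mul_le hP h1 a k hk (fun i j => by
    have := mul_nonneg (add_nonneg (ha i) (ha j)) (hak i j)
    nlinarith) hW (hcomm ▸ hZ)
  obtain ⟨V, hV⟩ := hW.exists_unitary_le (hcomm ▸ hZ) hle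
  rw [hcomm] at hV
  obtain ⟨U, hU⟩ := abs_le_of_forall_nonneg
    (X := (∑ i, a i • P i) * (∑ i, (k i * a i) • P i)) (Z := ∑ i, (k i * a i ^ 2) • P i)
    (W := (∑ i, a i • P i) * (∑ i, k i • P i) * (∑ i, a i • P i)) fun U => by
      have := sum_conj_nonneg hP a k hk ((∑ i, a i • P i) * U)
      simpa only [conjTranspose_mul, hD, hB, Matrix.mul_assoc] using this
  refine ⟨U * V, hU.trans ?_⟩
  have h2 := mul_mul_conjTranspose_mono hV (U : Matrix m m ℂ)
  rw [le_iff] at h2 ⊢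
  convert h2.smul (a := (1 / 2 : ℝ)) (by norm_num) using 1
  simp only [Submonoid.coe_mul, conjTranspose_mul, Matrix.mul_assoc]
  module

/-! ### Spectral resolution. -/

/-- The functional calculus of a Hermitian matrix as a sum over its rank one spectral
projections. -/
theorem IsHermitian.exists_cfc_eq_sum {B : Matrix m m ℂ} (hB : B.IsHermitian) :
    ∃ E : m → Matrix m m ℂ, (∀ i, (E i).PosSemidef) ∧ ∑ i, E i = 1 ∧
      ∀ f : ℝ → ℝ, cfc f B = ∑ i, f (hB.eigenvalues i) • E i := by
  let U := hB.eigenvectorUnitary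
  let E : m → Matrix m m ℂ := fun i =>
    (U : Matrix m m ℂ) * diagonal (Pi.single i 1) * (U : Matrix m m ℂ)ᴴ
  have hE (f : m → ℝ) : ∑ i, f i • E i =
      (U : Matrix m m ℂ) * diagonal (fun i => (f i : ℂ)) * (U : Matrix m m ℂ)ᴴ := by
    have : diagonal (fun i => (f i : ℂ)) = ∑ i, f i • diagonal (Pi.single i (1 : ℂ)) := by
      ext k l
      by_cases h : k = l
      · subst h
        simp [Matrix.sum_apply, Pi.single_apply]
      · simp [Matrix.sum_apply, h]
    simp only [E, this, Matrix.mul_sum, Matrix.sum_mul, Matrix.mul_smul, Matrix.smul_mul]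
  refine ⟨E, fun i => (PosSemidef.diagonal ?_).mul_mul_conjTranspose_same _, ?_, fun f => ?_⟩
  · exact Pi.single_nonneg.mpr zero_le_one
  · have := hE fun _ => 1
    simpa [unitary_mul_conjTranspose_self] using this
  · rw [hE, hB.cfc_eq, IsHermitian.cfc, Unitary.conjStarAlgAut_apply]
    rfl

end Matrix

/-! ### Nonnegative concave functions on the half-line. -/

/-- Once it decreases, a concave function stays below a line of negative slope and eventually
becomes negative. -/
theorem ConcaveOn.monotoneOn_of_nonneg {h : ℝ → ℝ} (hc : ConcaveOn ℝ (Set.Ici 0) h)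
    (h0 : ∀ t, 0 ≤ t → 0 ≤ h t) : MonotoneOn h (Set.Ici 0) := by
  intro x hx y hy hxy
  rcases hxy.eq_or_lt with rfl | hlt
  · exact le_rfl
  by_contra! hlt2
  have key (z : ℝ) (hz : y < z) : h z ≤ h y - (h x - h y) / (y - x) * (z - y) := by
    have := hc.slope_anti_adjacent hx (show z ∈ Set.Ici 0 from le_trans hy hz.le) hlt hz
    have hzy : 0 < z - y := sub_pos.mpr hz
    rw [div_le_iff₀ hzy] at this
    have e : (h x - h y) / (y - x) = -((h y - h x) / (y - x)) := by ring
    rw [e]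
    linarith
  have hs : 0 < (h x - h y) / (y - x) := div_pos (sub_pos.mpr hlt2) (sub_pos.mpr hlt)
  -- This far beyond `y`, the line has reached the value `-1`.
  have hw : 0 < (h y + 1) / ((h x - h y) / (y - x)) := div_pos (by linarith [h0 y hy]) hs
  have := key (y + (h y + 1) / ((h x - h y) / (y - x))) (by linarith)
  rw [add_sub_cancel_left, mul_div_cancel₀ _ hs.ne'] at this
  have := h0 (y + (h y + 1) / ((h x - h y) / (y - x))) (by linarith [show (0 : ℝ) ≤ y from hy])
  linarith

/-- A nonnegative concave function on the half-line has `t ↦ h t / t` antitone. -/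
theorem ConcaveOn.mul_le_mul_of_nonneg {h : ℝ → ℝ} (hc : ConcaveOn ℝ (Set.Ici 0) h)
    (h0 : ∀ t, 0 ≤ t → 0 ≤ h t) {s t : ℝ} (hs : 0 ≤ s) (hst : s ≤ t) :
    s * h t ≤ t * h s := by
  rcases (hs.trans hst).eq_or_lt with rfl | ht
  · rw [le_antisymm hst hs]
  have := hc.2 (Set.mem_Ici.mpr (le_refl (0 : ℝ))) (show t ∈ Set.Ici 0 from ht.le)
    (sub_nonneg.mpr ((div_le_one ht).mpr hst)) (div_nonneg hs ht.le)
    (sub_add_cancel 1 (s / t))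
  simp only [smul_eq_mul, mul_zero, zero_add, div_mul_cancel₀ _ ht.ne'] at this
  have h3 : 0 ≤ (1 - s / t) * h 0 :=
    mul_nonneg (sub_nonneg.mpr ((div_le_one ht).mpr hst)) (h0 0 le_rfl)
  have h4 : s / t * h t ≤ h s := by linarith
  rw [div_mul_eq_mul_div, div_le_iff₀ ht] at h4
  linarith

theorem ConcaveOn.eq_zero_of_eq_zero {h : ℝ → ℝ} (hc : ConcaveOn ℝ (Set.Ici 0) h)
    (h0 : ∀ t, 0 ≤ t → 0 ≤ h t) {s : ℝ} (hs : 0 < s) (hz : h s = 0) {t : ℝ} (ht : 0 ≤ t) :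
    h t = 0 := by
  rcases le_total t s with hts | hst
  · exact le_antisymm (hz ▸ hc.monotoneOn_of_nonneg h0 ht hs.le hts) (h0 t ht)
  · have := hc.mul_le_mul_of_nonneg h0 hs.le hst
    rw [hz, mul_zero] at this
    exact le_antisymm (nonpos_of_mul_nonpos_right this hs) (h0 t ht)

theorem ConcaveOn.monotoneOn_div {h : ℝ → ℝ} (hc : ConcaveOn ℝ (Set.Ici 0) h)
    (h0 : ∀ t, 0 ≤ t → 0 ≤ h t) : MonotoneOn (fun t => t / h t) (Set.Ici 0) := by
  intro s hs t ht hst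
  simp only
  rcases (h0 s hs).eq_or_lt with hz | hz
  · rw [← hz, div_zero]
    exact div_nonneg ht (h0 t ht)
  · rw [div_le_div_iff₀ hz (hz.trans_le (hc.monotoneOn_of_nonneg h0 hs ht hst))]
    exact hc.mul_le_mul_of_nonneg h0 hs hst

/-! ### The theorem. -/

theorem corollary2p4 {n d : ℕ} (A B : Matrix (Fin n) (Fin n) ℂ)
    (hAB : IsConcaveMonotonePair A B)
    (Φ : Matrix (Fin n) (Fin n) ℂ →ₚ[ℂ] Matrix (Fin d) (Fin d) ℂ) (hΦ : Φ 1 = 1) :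
    (∃ V : Matrix.unitaryGroup (Fin d) ℂ,
      CFC.abs (Φ A * Φ B) ≤
        (1 / 2 : ℝ) • (Φ (A * B) +
          (V : Matrix (Fin d) (Fin d) ℂ) * Φ (A * B) *
            star (V : Matrix (Fin d) (Fin d) ℂ))) ∧
    ∀ N : Seminorm ℂ (Matrix (Fin d) (Fin d) ℂ), IsSymmetricNorm N →
      N (Φ A * Φ B) ≤ N (Φ (A * B)) := by
  obtain ⟨⟨C, f, g, hC, -, -, -, hg, -, hBC⟩, h, hc, h0, hA⟩ := hAB
  have hB : B.PosSemidef := by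
    rw [← nonneg_iff_posSemidef, hBC]
    exact cfc_nonneg fun x hx => hg x (spectrum_nonneg_of_nonneg hC hx)
  have hsa : IsSelfAdjoint B := hB.1
  have hcont (f : ℝ → ℝ) : ContinuousOn f (spectrum ℝ B) := finite_real_spectrum.continuousOn f
  have hABc : A * B = cfc (fun t => h t * t) B := by
    rw [cfc_mul h (fun t => t) B (hcont _) (hcont _), cfc_id' ℝ B, ← hA]
  obtain ⟨E, hE, hE1, hcfc⟩ := hB.1.exists_cfc_eq_sum
  have hb := hB.eigenvalues_nonneg
  set b := hB.1.eigenvalues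
  have hsmul (r : ℝ) (X : Matrix (Fin n) (Fin n) ℂ) : Φ (r • X) = r • Φ X := by
    rw [← Complex.coe_smul, map_smul, Complex.coe_smul]
  have hΦA : Φ A = ∑ i, h (b i) • Φ (E i) := by
    simp only [hA, hcfc, map_sum, hsmul]
  have hΦB : Φ B = ∑ i, b i • Φ (E i) := by
    conv_lhs => rw [← cfc_id' ℝ B]
    simp only [hcfc, map_sum, hsmul]
  have hΦAB : Φ (A * B) = ∑ i, (h (b i) * b i) • Φ (E i) := by
    simp only [hABc, hcfc, map_sum, hsmul]
  have hP (i) : (Φ (E i)).PosSemidef :=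
    nonneg_iff_posSemidef.mp (map_nonneg Φ (nonneg_iff_posSemidef.mpr (hE i)))
  have hP1 : ∑ i, Φ (E i) = 1 := by rw [← map_sum, hE1, hΦ]
  have hZ : (Φ (A * B)).PosSemidef :=
    hΦAB ▸ posSemidef_sum_smul hP fun i => mul_nonneg (h0 _ (hb i)) (hb i)
  have hV : ∃ V : Matrix.unitaryGroup (Fin d) ℂ, CFC.abs (Φ A * Φ B) ≤
      (1 / 2 : ℝ) • (Φ (A * B) + (V : Matrix (Fin d) (Fin d) ℂ) * Φ (A * B) *
        star (V : Matrix (Fin d) (Fin d) ℂ)) := by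
    -- A zero of `h` at a positive point forces `h = 0` on the half-line, so `Φ A = 0`. Otherwise
    -- `h` can vanish only at `0`, where the convention `0 / 0 = 0` keeps `kᵢaᵢ = bᵢ`.
    by_cases hdeg : ∃ s, 0 < s ∧ h s = 0
    · obtain ⟨s, hs, hz⟩ := hdeg
      have hz' (i) : h (b i) = 0 := hc.eq_zero_of_eq_zero h0 hs hz (hb i)
      refine ⟨1, ?_⟩
      simp [hΦAB, hΦA, hz']
    · push Not at hdeg
      have hkb (i) : b i / h (b i) * h (b i) = b i := by
        rcases (hb i).eq_or_lt with hi | hi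
        · rw [show b i = 0 from hi.symm, zero_div, zero_mul]
        · exact div_mul_cancel₀ _ (hdeg _ hi)
      have key := exists_unitary_abs_sum_mul_sum_le hP hP1 (fun i => h (b i))
        (fun i => b i / h (b i)) (fun i => h0 _ (hb i))
        (fun i => div_nonneg (hb i) (h0 _ (hb i))) (fun i j => by
          rcases le_total (b i) (b j) with hij | hij
          · exact mul_nonneg_of_nonpos_of_nonpos
              (sub_nonpos.mpr (hc.monotoneOn_of_nonneg h0 (hb i) (hb j) hij))
              (sub_nonpos.mpr (hc.monotoneOn_div h0 (hb i) (hb j) hij))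
          · exact mul_nonneg
              (sub_nonneg.mpr (hc.monotoneOn_of_nonneg h0 (hb j) (hb i) hij))
              (sub_nonneg.mpr (hc.monotoneOn_div h0 (hb j) (hb i) hij)))
      have hsq (i) : b i / h (b i) * h (b i) ^ 2 = h (b i) * b i := by
        rw [sq, ← mul_assoc, hkb, mul_comm]
      simp only [hkb, hsq] at key
      rwa [← hΦA, ← hΦB, ← hΦAB] at key
  refine ⟨hV, fun N hN => ?_⟩
  obtain ⟨V, hV⟩ := hV
  obtain ⟨U, hU⟩ := exists_unitary_mul_abs (Φ A * Φ B)
  have habs := posSemidef_abs (Φ A * Φ B)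
  have hN1 : N (Φ A * Φ B) = N (CFC.abs (Φ A * Φ B)) := by
    conv_lhs => rw [hU]
    exact hN.unitary_mul U _
  rw [hN1]
  exact (hN.mono habs (nonneg_iff_posSemidef.mp (habs.nonneg.trans hV)) hV).trans
    (Seminorm.half_smul_add_le le_rfl (hN.unitary_invariant V (star V) _).le)
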